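/- For complex numbers $x,q$ let $(x;q)_0=1$ and $(x;q)_n=\prod_{k=0}^{n-1}(1-xq^k)$ for $n\ge 1$, write $$\left[\begin{matrix}x_1,\dots,x_r\\ y_1,\dots,y_s\end{matrix}\,\Big|\,q\right]_n=\frac{(x_1;q)_n\cdots(x_r;q)_n}{(y_1;q)_n\cdots(y_s;q)_n},$$ and let $${}_4\phi_3\left[\begin{matrix}a_0,a_1,a_2,a_3\\ b_1,b_2,b_3\end{matrix}\,\Big|\,q;z\right]=\sum_{k=0}^{\infty}\left[\begin{matrix}a_0,a_1,a_2,a_3\\ q,b_1,b_2,b_3\end{matrix}\,\Big|\,q\right]_k z^k .$$ Let $n,\ell,m$ be nonnegative integers and let $q,a,c$ be nonzero complex numbers with $q$ not a root of unity. Fix arbitrary square roots $\sqrt q,\sqrt a,\sqrt c$ and put $\sqrt{qac}=\sqrt q\sqrt a\sqrt c$, $\sqrt{qa/c}=\sqrt q\sqrt a/\sqrt c$, $q^{5/2}=(\sqrt q)^5$, $(c/a)^{1/2}=\sqrt c/\sqrt a$. Assume that no denominator in the formula below vanishes (on the left-hand side only the terms $k\le n$ are considered, since the numerator factor $(q^{-n};q)_k$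 vanishes for $k>n$). Then $$\begin{aligned} &{}_4\phi_3\left[\begin{matrix}q^{-n},\,q^{1+\ell+n},\,\sqrt{qac},\,-q^{m}\sqrt{qac}\\ -q,\,q^{1+\ell+m}a,\,qc\end{matrix}\,\Big|\,q;q\right] =\left[\begin{matrix}q^{-n}\sqrt{qa/c},\,-q^{m-n}\sqrt{qa/c},\,q^{1+\ell+n}\\ q^{1+\ell+m}a,\,q^{-n}/c,\,-q\end{matrix}\,\Big|\,q\right]_{n} \left[\begin{matrix}q^{m-n}a,\,\sqrt{qac}\\ q^{m}ac,\,q^{-n}\sqrt{qa/c}\end{matrix}\,\Big|\,q\right]_{m}\\ &\quad\times\sum_{i=0}^{\ell}\sum_{j=0}^{m}(-1)^i q^{(n+\frac52)j-ni+\binom{i+1}{2}}\Big(\frac ca\Big)^{\frac j2}\frac{1-q^{2m-2j}ac}{1-q^{2m}ac}\\ &\qquad\times\left[\begin{matrix}q^{-\ell},\,q^{-\ell-n},\,-q^{-\ell-n},\,q^{2m-n-j}a,\,q^{j-n}/c\\ q,\,q^{m-n}\sqrt{qa/c},\,-q^{m-n}\sqrt{qa/c},\,q^{-\ell-2n},\,q^{i-2\ell-2n-1}\end{matrix}\,\Big|\,q\right]_i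 \left[\begin{matrix}q^{-m},\,q^{-n}/c,\,q^{-2m}/(ac)\\ q,\,q^{1-2m+n}/a,\,q^{1-m}/(ac)\end{matrix}\,\Big|\,q\right]_j\\ &\qquad\times\left[\begin{matrix}q^{1+2m-n+i-j}a,\,q^{1-n+i+j}/c\\ q,\,q^{1+2m-2n+2i}a/c\end{matrix}\,\Big|\,q^2\right]_{\ell+n-i}. \end{aligned}$$ -/

import Mathlib

/-- The `q`-shifted factorial `(x; q)_n = ∏_{k=0}^{n-1} (1 - x q^k)`. -/
noncomputable def qShifted (x q : ℂ) (n : ℕ) : ℂ :=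
  ∏ k ∈ Finset.range n, (1 - x * q ^ k)

/-- The fraction form of the `q`-shifted factorials: the product of `(x; q)_n` over the upper
parameters `x`, divided by the product of `(y; q)_n` over the lower parameters `y`. -/
noncomputable def qFrac (q : ℂ) (upper lower : List ℂ) (n : ℕ) : ℂ :=
  (upper.map fun x => qShifted x q n).prod / (lower.map fun y => qShifted y q n).prod

/-- The `k`-th summand of the basic hypergeometric series with the given upper and lower
parameters, base `q` and argument `z`. -/
noncomputable def qHypTerm (q z : ℂ) (upper lower : List ℂ) (k : ℕ) : ℂ :=
  qFrac q upper (q :: lower) k * z ^ k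

/-- The basic hypergeometric series with one more upper than lower parameters, as an infinite
sum. -/
noncomputable def qHyp (q z : ℂ) (upper lower : List ℂ) : ℂ :=
  ∑' k : ℕ, qHypTerm q z upper lower k

/-!
The series is terminating, and the identity follows by reducing it, in three stages, to a series
that can be summed.

Sears' transformation of terminating balanced `₄φ₃` series, with the order of summation reversed
(`sears_reversed`), gives the first prefactor times a series whose summand contains, as a function
of `k`, the factor `(q ^ (-n) / c)_k (q ^ (m - n) a)_k / (q ^ (-n) √(q a / c))_k`. It rests on the
`q`-Pfaff–Saalschütz summation, used twice.

This factor is a combination, with coefficients indexed by `j ≤ m`, of the factors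
`(q ^ (j - n) / c)_k (q ^ (2 m - n - j) a)_k / (q ^ (m - n) √(q a / c))_k` (`expand_shifted`), so
the series becomes a sum over `j` of series with `m = 0` and shifted `a`, `c`. In each of these,
`(q ^ (-n))_k / (q ^ (-l - 2 n))_k` is a combination over `i ≤ l` of the same factor with `l = 0`
and shifted parameters (`expand_degree`). Both expansions are instances of one summation,
`wellPoised`, the terminating very-well-poised `₆φ₅` with a free parameter at `√(A q)`.

The remaining series, indexed by `i` and `j`, is summed by Andrews' terminating `q`-Watson formula
(`watson`), which produces the base-`q ^ 2` factor of the right-hand side.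

The three summations are proved by induction on the length of the sum, through
`sum_range_eq_mul_of_split`.
-/

/-! ### Shifted factorials -/

theorem qShifted_zero (x q : ℂ) : qShifted x q 0 = 1 := by simp [qShifted]

theorem qShifted_succ (x q : ℂ) (n : ℕ) :
    qShifted x q (n + 1) = qShifted x q n * (1 - x * q ^ n) := by
  simp [qShifted, Finset.prod_range_succ]

theorem qShifted_add (x q : ℂ) (m n : ℕ) :
    qShifted x q (m + n) = qShifted x q m * qShifted (x * q ^ m) q n := by
  simp only [qShifted, Finset.prod_range_add, pow_add, mul_assoc]

theorem qShifted_succ' (x q : ℂ) (n : ℕ) :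
    qShifted x q (n + 1) = (1 - x) * qShifted (x * q) q n := by
  rw [add_comm, qShifted_add, pow_one]; simp [qShifted]

theorem qShifted_mul_comm (x q : ℂ) (m n : ℕ) :
    qShifted x q m * qShifted (x * q ^ m) q n = qShifted x q n * qShifted (x * q ^ n) q m := by
  rw [← qShifted_add, ← qShifted_add, add_comm]

theorem qShifted_ne_zero_of_le {x q : ℂ} {m n : ℕ} (h : qShifted x q n ≠ 0) (hmn : m ≤ n) :
    qShifted x q m ≠ 0 := by
  obtain ⟨r, rfl⟩ := Nat.exists_eq_add_of_le hmn
  rw [qShifted_add] at h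
  exact left_ne_zero_of_mul h

theorem qShifted_ne_zero {x q : ℂ} {n : ℕ} (h : ∀ k < n, x * q ^ k ≠ 1) :
    qShifted x q n ≠ 0 := by
  refine Finset.prod_ne_zero_iff.2 fun k hk => sub_ne_zero.2 (h k ?_).symm
  exact Finset.mem_range.1 hk

theorem qShifted_eq_zero {x q : ℂ} {k n : ℕ} (h : x * q ^ k = 1) (hk : k < n) :
    qShifted x q n = 0 :=
  Finset.prod_eq_zero (Finset.mem_range.2 hk) (by rw [h, sub_self])

theorem qShifted_self_ne_zero {q : ℂ} (hroot : ∀ k : ℕ, 0 < k → q ^ k ≠ 1) (n : ℕ) :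
    qShifted q q n ≠ 0 :=
  qShifted_ne_zero fun k _ => by rw [← pow_succ']; exact hroot _ k.succ_pos

theorem one_sub_mul_pow_ne_zero {q : ℂ} (hroot : ∀ k : ℕ, 0 < k → q ^ k ≠ 1) (n : ℕ) :
    1 - q * q ^ n ≠ 0 := by
  rw [← pow_succ']; exact sub_ne_zero.2 (hroot _ n.succ_pos).symm

theorem qShifted_mul_neg (x q : ℂ) (n : ℕ) :
    qShifted x q n * qShifted (-x) q n = qShifted (x ^ 2) (q ^ 2) n := by
  simp only [qShifted, ← Finset.prod_mul_distrib]
  refine Finset.prod_congr rfl fun k _ => ?_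
  ring

theorem pow_choose_two_succ (q : ℂ) (n : ℕ) :
    q ^ (n + 1).choose 2 = q ^ n.choose 2 * q ^ n := by
  rw [Nat.choose_succ_succ' n 1, Nat.choose_one_right, pow_add, mul_comm]

/-- Reversal of the factors of a shifted factorial. The parameters `x` and `x'` are related by
`x' = q ^ (1 - n - k) / x`, so that the factor of index `i` on one side is, up to a monomial, the
factor of index `n + k - 1 - i` on the other. -/
theorem qShifted_reverse {q : ℂ} (hq : q ≠ 0) (x x' : ℂ) (n k : ℕ)
    (h : x * x' * q ^ (n + k) = q) :
    qShifted x q n * qShifted x' q k =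
      (-x) ^ n * q ^ n.choose 2 * qShifted x' q (n + k) := by
  induction n generalizing k with
  | zero => simp [qShifted_zero]
  | succ n ih =>
    have h1 := ih (k + 1) (by linear_combination h)
    rw [show n + (k + 1) = n + 1 + k by ring, qShifted_succ x'] at h1
    have h2 : x * x' * q ^ n * q ^ k = 1 := by
      apply mul_left_cancel₀ hq
      linear_combination h
    rw [qShifted_succ, pow_choose_two_succ]
    linear_combination (-x * q ^ n) * h1 - qShifted x q n * qShifted x' q k * h2

/-- The telescoping step of every summation below: a sum over `j ≤ m + 1` equals `F` times a sum
over `j ≤ m` as soon as each new term is obtained by splitting `F * f j` into a part `R j` that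
moves to index `j + 1` and a part that stays at index `j`. -/
theorem sum_range_eq_mul_of_split {f g R : ℕ → ℂ} {F : ℂ} (m : ℕ)
    (h0 : g 0 = F * f 0 - R 0)
    (hs : ∀ j r, m = j + 1 + r → g (j + 1) = F * f (j + 1) - R (j + 1) + R j)
    (hl : g (m + 1) = R m) :
    ∑ j ∈ Finset.range (m + 1 + 1), g j = F * ∑ j ∈ Finset.range (m + 1), f j := by
  have key : ∀ t, t ≤ m → ∑ j ∈ Finset.range (t + 1), g j =
      F * ∑ j ∈ Finset.range (t + 1), f j - R t := by
    intro t
    induction t with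
    | zero => intro _; simpa using h0
    | succ t ih =>
      intro ht
      obtain ⟨r, hr⟩ := Nat.exists_eq_add_of_le ht
      rw [Finset.sum_range_succ, ih (by omega), hs t r hr, Finset.sum_range_succ _ (t + 1)]
      ring
  rw [Finset.sum_range_succ, key m le_rfl, hl]
  ring

/-! ### Three terminating summations -/

/-- The `q`-Pfaff–Saalschütz summation, in a form without denominators in the parameters. -/
theorem saalschuetz {q : ℂ} (hroot : ∀ k : ℕ, 0 < k → q ^ k ≠ 1) (b c u : ℂ) (n : ℕ) :
    ∑ j ∈ Finset.range (n + 1),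
      qShifted q q n / (qShifted q q j * qShifted q q (n - j)) *
        (qShifted b q j * qShifted c q j * qShifted (b * c * u * q ^ j) q (n - j) *
          qShifted u q (n - j) * u ^ j) =
    qShifted (c * u) q n * qShifted (b * u) q n := by
  have hP := qShifted_self_ne_zero hroot
  have hI := one_sub_mul_pow_ne_zero hroot
  induction n with
  | zero => simp [qShifted_zero]
  | succ n ih =>
    -- The split is `(1 - c u q ^ n) (1 - b u q ^ n) = (1 - b q ^ j) (1 - c q ^ j) u q ^ (n - j)
    -- + (1 - u q ^ (n - j)) (1 - b c u q ^ (n + j))`.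
    rw [sum_range_eq_mul_of_split
      (F := (1 - c * u * q ^ n) * (1 - b * u * q ^ n))
      (f := fun j => qShifted q q n / (qShifted q q j * qShifted q q (n - j)) *
        (qShifted b q j * qShifted c q j * qShifted (b * c * u * q ^ j) q (n - j) *
          qShifted u q (n - j) * u ^ j))
      (R := fun j => qShifted q q n / (qShifted q q j * qShifted q q (n - j)) *
        (qShifted b q j * qShifted c q j * qShifted (b * c * u * q ^ j) q (n - j) *
          qShifted u q (n - j) * u ^ j) *
        ((1 - b * q ^ j) * (1 - c * q ^ j) * u * q ^ (n - j))), ih, qShifted_succ, qShifted_succ]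
    · ring
    · simp only [Nat.sub_zero, qShifted_zero, qShifted_succ, pow_zero, mul_one]
      have := hP n; have := hI n
      field_simp
      ring
    · rintro j r rfl
      rw [show j + 1 + r + 1 - (j + 1) = r + 1 by omega, show j + 1 + r - (j + 1) = r by omega,
        show j + 1 + r - j = r + 1 by omega]
      rw [qShifted_succ' (b * c * u * q ^ j),
        show b * c * u * q ^ j * q = b * c * u * q ^ (j + 1) by ring]
      simp only [qShifted_succ]
      have := hP (j + r); have := hI r; have := hP j; have := hI j; have := hP r; have := hI (j + r)
      field_simp
      ring
    · simp only [Nat.sub_self, qShifted_zero, qShifted_succ, pow_zero, mul_one]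
      have := hP n; have := hI n
      field_simp
      ring

/-- The case of the terminating very-well-poised `₆φ₅` summation with base parameter `A` in which
one of the free parameters is `w = √(A q)` and hence cancels against its partner. The other free
parameter is `C`, with `e = w / C` and partner `A q / C = e w`. The identity is multiplied
through by `(w; q)_m` and `(e w; q)_m`, which are therefore allowed to vanish. -/
theorem wellPoised {q : ℂ} (hq : q ≠ 0) (hroot : ∀ k : ℕ, 0 < k → q ^ k ≠ 1) (A w C e : ℂ)
    (hA : A * q = w ^ 2) (hw : C * e = w) (m : ℕ) (hne : qShifted A q (2 * m + 1) ≠ 0) :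
    ∑ j ∈ Finset.range (m + 1),
      qShifted q q m / (qShifted q q j * qShifted q q (m - j)) *
        ((-1) ^ j * q ^ j.choose 2 * (1 - A * q ^ (2 * j)) * qShifted A q j *
          (qShifted C q j * e ^ j) * qShifted (e * w * q ^ j) q (m - j) * qShifted w q m /
            qShifted A q (m + j + 1)) =
    qShifted e q m := by
  have hP := qShifted_self_ne_zero hroot
  have hI := one_sub_mul_pow_ne_zero hroot
  -- With `v = w / q` every quantity is polynomial: `w = q * v` and `A = q * v ^ 2`.
  obtain ⟨v, rfl⟩ : ∃ v, w = q * v := ⟨w / q, by field_simp⟩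
  obtain rfl : A = q * v ^ 2 := mul_right_cancel₀ hq (by rw [hA]; ring)
  have hC : ∀ j, qShifted C q (j + 1) * e ^ (j + 1) =
      qShifted C q j * e ^ j * (e - q * v * q ^ j) := fun j => by
    rw [qShifted_succ, ← hw]; ring
  induction m with
  | zero =>
    have : 1 - q * v ^ 2 ≠ 0 := by simpa [qShifted] using hne
    simp [qShifted, this]
  | succ m ih =>
    have hN : ∀ i, i ≤ 2 * m + 3 → qShifted (q * v ^ 2) q i ≠ 0 := fun i hi =>
      qShifted_ne_zero_of_le hne (by omega)
    have hN' : ∀ i, i ≤ 2 * m + 2 → 1 - q * v ^ 2 * q ^ i ≠ 0 := fun i hi => by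
      have := hN (i + 1) (by omega)
      rw [qShifted_succ] at this
      exact right_ne_zero_of_mul this
    rw [sum_range_eq_mul_of_split
      (F := 1 - e * q ^ m)
      (f := fun j => qShifted q q m / (qShifted q q j * qShifted q q (m - j)) *
        ((-1) ^ j * q ^ j.choose 2 * (1 - q * v ^ 2 * q ^ (2 * j)) * qShifted (q * v ^ 2) q j *
          (qShifted C q j * e ^ j) * qShifted (e * (q * v) * q ^ j) q (m - j) *
          qShifted (q * v) q m / qShifted (q * v ^ 2) q (m + j + 1)))
      (R := fun j => -(qShifted q q m / (qShifted q q j * qShifted q q (m - j)) *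
        ((-1) ^ j * q ^ j.choose 2 * qShifted (q * v ^ 2) q j *
          (qShifted C q j * e ^ j) * qShifted (e * (q * v) * q ^ j) q (m - j) *
          qShifted (q * v) q m / qShifted (q * v ^ 2) q (m + j + 1))) *
        (q ^ m * (e - q * v * q ^ j) * (1 - q * v * q ^ j) * (1 - q * v ^ 2 * q ^ j) /
          (1 - q * v ^ 2 * q ^ (m + j + 1)))), ih, qShifted_succ]
    · ring
    · exact qShifted_ne_zero_of_le hne (by omega)
    · simp only [Nat.sub_zero, qShifted_zero, qShifted_succ, pow_zero, mul_one, Nat.mul_zero,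
        Nat.add_zero]
      have := hP m; have := hI m; have := hN m (by omega); have := hN' m (by omega)
      have := hN' (m + 1) (by omega)
      field_simp
      ring
    · rintro j r rfl
      rw [show j + 1 + r + 1 - (j + 1) = r + 1 by omega, show j + 1 + r - (j + 1) = r by omega,
        show j + 1 + r - j = r + 1 by omega,
        show j + 1 + r + 1 + (j + 1) + 1 = (j + 1 + r + j + 1) + 1 + 1 by ring,
        show j + 1 + r + (j + 1) + 1 = (j + 1 + r + j + 1) + 1 by ring]
      rw [qShifted_succ' (e * (q * v) * q ^ j),
        show e * (q * v) * q ^ j * q = e * (q * v) * q ^ (j + 1) by ring]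
      rw [hC]
      simp only [qShifted_succ, pow_choose_two_succ]
      have := hP j; have := hI j; have := hP r; have := hI r; have := hI (j + 1 + r)
      have := hN (j + 1 + r + j) (by omega)
      have := hN' (j + 1 + r + j) (by omega)
      have := hN' (j + 1 + r + j + 1) (by omega)
      have := hN' (j + 1 + r + j + 1 + 1) (by omega)
      field_simp
      ring
    · rw [Nat.sub_self, Nat.sub_self, hC,
        show m + 1 + (m + 1) + 1 = (m + m + 1) + 1 + 1 by ring]
      simp only [qShifted_zero, qShifted_succ, pow_choose_two_succ]
      have := hP m; have := hI m
      have := hN (m + m) (by omega)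
      have := hN' (m + m) (by omega)
      have := hN' (m + m + 1 + 1) (by omega)
      field_simp
      ring

/-- Andrews' terminating `q`-analogue of Watson's summation, cleared of denominators: it evaluates
the `₄φ₃` with upper parameters `q ^ (-n), -q ^ (-n), x, y` and lower parameters `q ^ (-2 * n)`
and the two square roots of `q * x * y`. -/
theorem watson {q : ℂ} (hroot : ∀ k : ℕ, 0 < k → q ^ k ≠ 1) (x y : ℂ) (n : ℕ) :
    ∑ k ∈ Finset.range (n + 1),
      qShifted q q (2 * n - k) / (qShifted (q ^ 2) (q ^ 2) (n - k) * qShifted q q k) *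
        (qShifted x q k * qShifted y q k * qShifted (x * y * q ^ (2 * k + 1)) (q ^ 2) (n - k) *
          q ^ (k + 1).choose 2) =
    qShifted (q * x) (q ^ 2) n * qShifted (q * y) (q ^ 2) n := by
  have hroot2 : ∀ k : ℕ, 0 < k → (q ^ 2) ^ k ≠ 1 := fun k hk => by
    rw [← pow_mul]; exact hroot _ (by omega)
  have hI := one_sub_mul_pow_ne_zero hroot
  have hP2 := qShifted_self_ne_zero hroot2
  have hI2 := one_sub_mul_pow_ne_zero hroot2
  induction n with
  | zero => simp [qShifted_zero]
  | succ n ih =>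
    -- The part of `F` that does not move is
    -- `(1 - q ^ (2 n + 1 - k)) (1 - x y q ^ (2 n + 1 + k))`.
    rw [sum_range_eq_mul_of_split
      (F := (1 - x * q ^ (2 * n + 1)) * (1 - y * q ^ (2 * n + 1)))
      (f := fun k => qShifted q q (2 * n - k) /
          (qShifted (q ^ 2) (q ^ 2) (n - k) * qShifted q q k) *
        (qShifted x q k * qShifted y q k * qShifted (x * y * q ^ (2 * k + 1)) (q ^ 2) (n - k) *
          q ^ (k + 1).choose 2))
      (R := fun k => qShifted q q (2 * n - k) /
          (qShifted (q ^ 2) (q ^ 2) (n - k) * qShifted q q k) *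
        (qShifted x q k * qShifted y q k * qShifted (x * y * q ^ (2 * k + 1)) (q ^ 2) (n - k) *
          q ^ (k + 1).choose 2) *
        (q ^ (2 * n + 1 - k) * (1 - x * q ^ k) * (1 - y * q ^ k))), ih,
      qShifted_succ, qShifted_succ]
    · ring
    · simp only [Nat.sub_zero, qShifted_zero, pow_zero, mul_one, Nat.mul_add,
        qShifted_succ, Nat.mul_zero]
      have := hP2 n; have := hI2 n
      field_simp
      ring
    · rintro k r rfl
      rw [show 2 * (k + 1 + r + 1) - (k + 1) = k + 1 + 2 * r + 1 + 1 by omega,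
        show k + 1 + r + 1 - (k + 1) = r + 1 by omega,
        show 2 * (k + 1 + r) - (k + 1) = k + 1 + 2 * r by omega,
        show k + 1 + r - (k + 1) = r by omega,
        show 2 * (k + 1 + r) + 1 - (k + 1) = k + 1 + 2 * r + 1 by omega,
        show 2 * (k + 1 + r) - k = k + 1 + 2 * r + 1 by omega,
        show k + 1 + r - k = r + 1 by omega,
        show 2 * (k + 1 + r) + 1 - k = k + 1 + 2 * r + 1 + 1 by omega]
      rw [qShifted_succ' (x * y * q ^ (2 * k + 1)),
        show x * y * q ^ (2 * k + 1) * q ^ 2 = x * y * q ^ (2 * (k + 1) + 1) by ring]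
      simp only [qShifted_succ, pow_choose_two_succ]
      have := hI k; have := hI2 r
      field_simp
      ring
    · rw [Nat.sub_self, Nat.sub_self, show 2 * (n + 1) - (n + 1) = n + 1 by omega,
        show 2 * n - n = n by omega, show 2 * n + 1 - n = n + 1 by omega]
      simp only [qShifted_zero, qShifted_succ, pow_choose_two_succ]
      have := hI n
      field_simp

/-! ### A reversed Sears transformation -/

/-- The `q`-Pfaff–Saalschütz summation as a balanced `₃φ₂`; `y` stands for `q ^ (-n)`. -/
theorem saalschuetz_series {q : ℂ} (hq : q ≠ 0) (hroot : ∀ k : ℕ, 0 < k → q ^ k ≠ 1)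
    {y α β γ δ : ℂ} (n : ℕ) (hy : y * q ^ n = 1) (hbal : γ * δ * q ^ n = α * β * q)
    (hα : α ≠ 0) (hβ : β ≠ 0) (hγ0 : γ ≠ 0) (hδ0 : δ ≠ 0)
    (hγ : qShifted γ q n ≠ 0) (hδ : qShifted δ q n ≠ 0) :
    ∑ r ∈ Finset.range (n + 1),
      qShifted y q r * qShifted α q r * qShifted β q r /
        (qShifted q q r * qShifted γ q r * qShifted δ q r) * q ^ r =
    qShifted (γ / α) q n * qShifted (δ / α) q n * α ^ n / (qShifted γ q n * qShifted δ q n) := by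
  have hP := qShifted_self_ne_zero hroot
  have hS := saalschuetz hroot α β (γ / (α * β)) n
  rw [show β * (γ / (α * β)) = γ / α by field_simp,
    show α * (γ / (α * β)) = γ / β by field_simp,
    show α * β * (γ / (α * β)) = γ by field_simp] at hS
  -- The reversals of `δ` and of `δ / α`.
  have hδrev := qShifted_reverse hq δ (γ / (α * β)) n 0 (by
    rw [Nat.add_zero]; field_simp; linear_combination hbal)
  have hδα := qShifted_reverse hq (δ / α) (γ / β) n 0 (by
    rw [Nat.add_zero]; field_simp; linear_combination hbal)
  simp only [qShifted_zero, mul_one, Nat.add_zero] at hδrev hδα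
  have hu : qShifted (γ / (α * β)) q n ≠ 0 := by
    intro h; rw [h, mul_zero] at hδrev; exact hδ hδrev
  have hL : ∀ r ∈ Finset.range (n + 1),
      qShifted y q r * qShifted α q r * qShifted β q r /
        (qShifted q q r * qShifted γ q r * qShifted δ q r) * q ^ r =
      qShifted q q n / (qShifted q q r * qShifted q q (n - r)) *
        (qShifted α q r * qShifted β q r * qShifted (γ * q ^ r) q (n - r) *
          qShifted (γ / (α * β)) q (n - r) * (γ / (α * β)) ^ r) /
        (qShifted γ q n * qShifted (γ / (α * β)) q n) := by
    intro r hr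
    obtain ⟨t, rfl⟩ := Nat.exists_eq_add_of_le (Finset.mem_range_succ_iff.1 hr)
    rw [Nat.add_sub_cancel_left]
    have h1 := qShifted_reverse hq y q r t (by linear_combination q * hy)
    have h2 := qShifted_reverse hq δ (γ / (α * β)) r t (by
      field_simp; linear_combination hbal)
    have h3 := qShifted_add γ q r t
    have hδr : qShifted δ q r ≠ 0 := qShifted_ne_zero_of_le hδ (by omega)
    have hγr : qShifted γ q r ≠ 0 := qShifted_ne_zero_of_le hγ (by omega)
    have hγt : qShifted (γ * q ^ r) q t ≠ 0 := by rw [h3] at hγ; exact right_ne_zero_of_mul hγ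
    have hy' : qShifted y q r = (-y) ^ r * q ^ r.choose 2 * qShifted q q (r + t) / qShifted q q t :=
      by rw [← h1]; field_simp [hP t]
    have hu' : qShifted (γ / (α * β)) q t =
        (-δ) ^ r * q ^ r.choose 2 * qShifted (γ / (α * β)) q (r + t) / qShifted δ q r := by
      rw [← h2]; field_simp
    rw [hu', hy', h3]
    have := hP r; have := hP t; have := hP (r + t)
    have hk : y ^ r * q ^ r = δ ^ r * (γ / (α * β)) ^ r := by
      rw [← mul_pow, ← mul_pow]; congr 1
      field_simp
      linear_combination γ * δ * hy - y * hbal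
    have e1 : (-y) ^ r = (-1) ^ r * y ^ r := by rw [← mul_pow]; ring_nf
    have e2 : (-δ) ^ r = (-1) ^ r * δ ^ r := by rw [← mul_pow]; ring_nf
    rw [e1, e2]
    generalize γ / (α * β) = u at *
    generalize qShifted (γ * q ^ r) q t = G at *
    field_simp
    linear_combination qShifted α q r * qShifted β q r * hk
  rw [Finset.sum_congr rfl hL, ← Finset.sum_div, hS, hδrev, hδα]
  have e1 : (-(δ / α)) ^ n * α ^ n = (-δ) ^ n := by rw [← mul_pow]; congr 1; field_simp
  have : (-(δ / α)) ^ n ≠ 0 := pow_ne_zero _ (neg_ne_zero.2 (div_ne_zero hδ0 hα))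
  rw [← e1]
  generalize γ / (α * β) = u at *
  generalize γ / β = u' at *
  field_simp

/-- Interchange of summation over a triangle. -/
theorem sum_range_triangle (f : ℕ → ℕ → ℂ) (n : ℕ) :
    ∑ k ∈ Finset.range (n + 1), ∑ j ∈ Finset.range (k + 1), f k j =
      ∑ j ∈ Finset.range (n + 1), ∑ r ∈ Finset.range (n - j + 1), f (j + r) j := by
  rw [Finset.sum_sigma', Finset.sum_sigma']
  refine Finset.sum_bij' (fun x _ => ⟨x.2, x.1 - x.2⟩) (fun x _ => ⟨x.1 + x.2, x.1⟩) ?_ ?_ ?_ ?_ ?_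
  all_goals rintro ⟨a, b⟩ h
  all_goals simp only [Finset.mem_sigma, Finset.mem_range, Sigma.mk.injEq, heq_eq_eq, and_true,
    true_and] at h ⊢
  · omega
  · omega
  · omega
  · omega
  · rw [Nat.add_sub_cancel' (by omega)]

/-- Sears' transformation of a terminating balanced `₄φ₃`; `y` stands for `q ^ (-n)`. -/
theorem sears {q : ℂ} (hq : q ≠ 0) (hroot : ∀ k : ℕ, 0 < k → q ^ k ≠ 1)
    {y A b c u E F : ℂ} (n : ℕ) (hy : y * q ^ n = 1) (hbal : E * F * q ^ n = A * u * q)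
    (hA : A ≠ 0) (hu : u ≠ 0) (hE0 : E ≠ 0) (hF0 : F ≠ 0)
    (hD : qShifted (b * c * u) q n ≠ 0) (hE : qShifted E q n ≠ 0) (hF : qShifted F q n ≠ 0) :
    ∑ k ∈ Finset.range (n + 1),
      qShifted y q k * qShifted A q k * qShifted (c * u) q k * qShifted (b * u) q k /
        (qShifted q q k * qShifted (b * c * u) q k * qShifted E q k * qShifted F q k) * q ^ k =
    ∑ j ∈ Finset.range (n + 1),
      qShifted y q j * qShifted A q j * qShifted b q j * qShifted c q j /
        (qShifted q q j * qShifted (b * c * u) q j) * (u * q) ^ j *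
        (qShifted (E / A) q (n - j) * qShifted (F / A) q (n - j) * (A * q ^ j) ^ (n - j)) /
        (qShifted E q n * qShifted F q n) := by
  have hP := qShifted_self_ne_zero hroot
  have h1 : ∀ k ∈ Finset.range (n + 1),
      qShifted y q k * qShifted A q k * qShifted (c * u) q k * qShifted (b * u) q k /
        (qShifted q q k * qShifted (b * c * u) q k * qShifted E q k * qShifted F q k) * q ^ k =
      ∑ j ∈ Finset.range (k + 1),
        qShifted y q k * qShifted A q k * qShifted b q j * qShifted c q j * qShifted u q (k - j) /
          (qShifted q q j * qShifted q q (k - j) * qShifted (b * c * u) q j * qShifted E q k *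
            qShifted F q k) * u ^ j * q ^ k := by
    intro k hk
    have hkn := Finset.mem_range_succ_iff.1 hk
    rw [mul_assoc _ (qShifted (c * u) q k), ← saalschuetz hroot b c u k, Finset.mul_sum,
      Finset.sum_div, Finset.sum_mul]
    refine Finset.sum_congr rfl fun j hj => ?_
    obtain ⟨t, rfl⟩ := Nat.exists_eq_add_of_le (Finset.mem_range_succ_iff.1 hj)
    have hDk := qShifted_ne_zero_of_le hD hkn
    rw [qShifted_add] at hDk
    have := right_ne_zero_of_mul hDk
    rw [Nat.add_sub_cancel_left, qShifted_add (b * c * u)]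
    have := hP (j + t)
    field_simp
  rw [Finset.sum_congr rfl h1, sum_range_triangle]
  refine Finset.sum_congr rfl fun j hj => ?_
  obtain ⟨t, rfl⟩ := Nat.exists_eq_add_of_le (Finset.mem_range_succ_iff.1 hj)
  rw [Nat.add_sub_cancel_left]
  have hqj : q ^ j ≠ 0 := pow_ne_zero _ hq
  rw [qShifted_add] at hE hF
  have hS := saalschuetz_series hq hroot (y := y * q ^ j) (α := A * q ^ j) (β := u)
    (γ := E * q ^ j) (δ := F * q ^ j) t (by linear_combination hy)
    (by linear_combination q ^ j * hbal) (mul_ne_zero hA hqj) hu (mul_ne_zero hE0 hqj)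
    (mul_ne_zero hF0 hqj) (right_ne_zero_of_mul hE) (right_ne_zero_of_mul hF)
  rw [mul_div_mul_right _ _ hqj, mul_div_mul_right _ _ hqj] at hS
  rw [qShifted_add E, qShifted_add F, mul_mul_mul_comm (qShifted E q j),
    mul_div_mul_comm _ _ (qShifted E q j * _), ← hS, Finset.mul_sum]
  refine Finset.sum_congr rfl fun r hr => ?_
  rw [Nat.add_sub_cancel_left]
  simp only [qShifted_add _ q j r, mul_pow, pow_add]
  simp only [div_eq_mul_inv, mul_inv]
  ring

theorem pow_choose_two_sq_mul (q : ℂ) (n : ℕ) :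
    (q ^ n.choose 2) ^ 2 * q ^ n = q ^ (n * n) := by
  induction n with
  | zero => simp
  | succ n ih =>
    rw [pow_choose_two_succ]
    linear_combination q ^ (2 * n + 1) * ih

/-- Sears' transformation with the order of summation reversed. The parameters `A'`, `b'`, `c'`,
`D'` are the reversals of `A`, `b`, `c` and `D = b * c * u`; `y` stands for `q ^ (-n)`. -/
theorem sears_reversed {q : ℂ} (hq : q ≠ 0) (hroot : ∀ k : ℕ, 0 < k → q ^ k ≠ 1)
    {y A b c u E F A' b' c' D' : ℂ} (n : ℕ) (hy : y * q ^ n = 1)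
    (hbal : E * F * q ^ n = A * u * q)
    (hA : A ≠ 0) (hu : u ≠ 0) (hE0 : E ≠ 0) (hF0 : F ≠ 0)
    (hA' : A * A' * q ^ n = q) (hb' : b * b' * q ^ n = q) (hc' : c * c' * q ^ n = q)
    (hD' : b * c * u * D' * q ^ n = q) (hAn : qShifted A' q n ≠ 0)
    (hbn : qShifted b' q n ≠ 0) (hcn : qShifted c' q n ≠ 0)
    (hD : qShifted (b * c * u) q n ≠ 0) (hE : qShifted E q n ≠ 0) (hF : qShifted F q n ≠ 0) :
    ∑ k ∈ Finset.range (n + 1),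
      qShifted y q k * qShifted A q k * qShifted (c * u) q k * qShifted (b * u) q k /
        (qShifted q q k * qShifted (b * c * u) q k * qShifted E q k * qShifted F q k) * q ^ k =
    qShifted b' q n * qShifted c' q n * qShifted A q n /
        (qShifted F q n * qShifted D' q n * qShifted E q n) *
      ∑ k ∈ Finset.range (n + 1),
        qShifted y q k * qShifted D' q k * qShifted (E / A) q k * qShifted (F / A) q k /
          (qShifted q q k * qShifted A' q k * qShifted b' q k * qShifted c' q k) * q ^ k := by
  have hP := qShifted_self_ne_zero hroot
  rw [sears hq hroot n hy hbal hA hu hE0 hF0 hD hE hF, ← Finset.sum_range_reflect,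
    Finset.mul_sum]
  refine Finset.sum_congr rfl fun k hk => ?_
  obtain ⟨t, rfl⟩ := Nat.exists_eq_add_of_le' (Finset.mem_range_succ_iff.1 hk)
  rw [show t + k + 1 - 1 - k = t by omega, Nat.add_sub_cancel_left]
  have hq0 : ∀ i, q ^ i ≠ 0 := fun i => pow_ne_zero _ hq
  have hz : ∀ {x x' : ℂ}, x * x' * q ^ (t + k) = q → x ≠ 0 := by
    rintro x x' h rfl
    simp at h; exact hq h.symm
  have hrev : ∀ {x x' : ℂ}, x * x' * q ^ (t + k) = q → qShifted x' q (t + k) ≠ 0 →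
      qShifted x q t = (-x) ^ t * q ^ t.choose 2 * qShifted x' q (t + k) / qShifted x' q k :=
    fun h h' => by
      have := qShifted_ne_zero_of_le h' (Nat.le_add_left k t)
      rw [← qShifted_reverse hq _ _ _ _ h]; field_simp
  have hfull : ∀ {x x' : ℂ}, x * x' * q ^ (t + k) = q →
      qShifted x q (t + k) = (-x) ^ (t + k) * q ^ (t + k).choose 2 * qShifted x' q (t + k) :=
    fun h => by simpa [qShifted_zero] using qShifted_reverse hq _ _ (t + k) 0 (by simpa using h)
  have hyq : y * q * q ^ (t + k) = q := by linear_combination q * hy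
  have hqy : q * y * q ^ (t + k) = q := by linear_combination q * hy
  have hyn : qShifted y q (t + k) ≠ 0 := by
    intro h
    have := hfull hqy
    rw [h, mul_zero] at this
    exact hP _ this
  have hDn : qShifted D' q (t + k) ≠ 0 := by
    intro h
    have := hfull hD'
    rw [h, mul_zero] at this
    exact hD this
  rw [hrev hyq (hP _), hrev hqy hyn, hrev hA' hAn, hrev hb' hbn, hrev hc' hcn, hrev hD' hDn,
    hfull hA', hfull hqy]
  have hb0 := hz hb'
  have hc0 := hz hc'
  have hyt : y ^ t * q ^ (t * k) * (q ^ t.choose 2) ^ 2 * q ^ t = 1 := by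
    rw [mul_assoc, pow_choose_two_sq_mul, mul_assoc, ← pow_add, ← mul_add, add_comm k,
      mul_comm t, pow_mul, ← mul_pow, hy, one_pow]
  have hs : ((-1 : ℂ) ^ t) ^ 2 = 1 := by rw [← pow_mul, mul_comm, pow_mul]; norm_num
  have hyk := qShifted_ne_zero_of_le hyn (Nat.le_add_left k t)
  have := hP k
  have := qShifted_ne_zero_of_le hAn (Nat.le_add_left k t)
  have := qShifted_ne_zero_of_le hbn (Nat.le_add_left k t)
  have := qShifted_ne_zero_of_le hcn (Nat.le_add_left k t)
  have := qShifted_ne_zero_of_le hDn (Nat.le_add_left k t)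
  have := hq0 ((t + k).choose 2)
  generalize qShifted (E / A) q k = e1 at *
  generalize qShifted (F / A) q k = e2 at *
  generalize q ^ (t + k).choose 2 = e3 at *
  generalize q ^ t.choose 2 = e4 at *
  generalize qShifted D' q k = e5 at *
  simp only [neg_pow y, neg_pow q, neg_pow A, neg_pow b, neg_pow c, neg_pow (b * c * u), mul_pow,
    ← pow_mul, pow_add]
  generalize ((-1 : ℂ)) ^ t = s1 at *
  generalize ((-1 : ℂ)) ^ k = s2 at *
  field_simp
  linear_combination s1 ^ 3 * s2 * e1 * e2 * hyt + s1 * s2 * e1 * e2 * hs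

/-! ### Removing the parameter `m` -/

/-- Expansion of `(C)_k (q ^ m X)_k / (Z)_k`, as a function of `k`, over the functions
`(C q ^ j)_k (q ^ (2 m - j) X)_k / (q ^ m Z)_k` with `j ≤ m`. The quotient `(q ^ m Z)_k / (Z)_k` is
written as `(Z q ^ k)_m / (Z)_m`, and the constant `(Z)_m` is left out. Up to the reversal of some
factors it is the summation `wellPoised` with parameter `C q ^ k`; `y` stands for `q ^ (-m)`, and
`W`, `H`, `Z` are the reversals of `w`, `A q`, `e`. -/
theorem expand_shifted {q : ℂ} (hq : q ≠ 0) (hroot : ∀ k : ℕ, 0 < k → q ^ k ≠ 1)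
    {A w C e X Z W H y : ℂ} (m k : ℕ) (hA : A * q = w ^ 2) (hC : C * e = w)
    (hZ : Z * e * q ^ m = q) (hX : X * (e * w) * q ^ (2 * m) = q) (hW : W * w * q ^ m = q)
    (hH : H * (A * q) * q ^ m = q) (hy : y * q ^ m = 1)
    (hA0 : qShifted A q (2 * m + 1) ≠ 0) (hD : qShifted (e * w) q m ≠ 0) :
    qShifted C q k * qShifted (q ^ m * X) q k * qShifted (Z * q ^ k) q m =
      qShifted (q ^ m * X) q m * qShifted W q m / qShifted H q m *
      ∑ j ∈ Finset.range (m + 1),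
        (e * q ^ m) ^ j * ((1 - A * q ^ (2 * j)) / (1 - A)) *
          (qShifted y q j * qShifted C q j * qShifted A q j /
            (qShifted q q j * qShifted (e * w) q j * qShifted (A * q ^ (m + 1)) q j)) *
          (qShifted (C * q ^ j) q k * qShifted (q ^ (2 * m - j) * X) q k) := by
  have hP := qShifted_self_ne_zero hroot
  have hq0 : ∀ i, q ^ i ≠ 0 := fun i => pow_ne_zero _ hq
  have hqk := hq0 k
  have hw0 : w ≠ 0 := by rintro rfl; simp at hW; exact hq hW.symm
  have he0 : e ≠ 0 := by rintro rfl; simp at hX; exact hq hX.symm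
  have hV := wellPoised hq hroot A w (C * q ^ k) (e / q ^ k) hA (by rw [← hC]; field_simp) m hA0
  have hfull : ∀ {x x' : ℂ} (n : ℕ), x * x' * q ^ n = q →
      qShifted x q n = (-x) ^ n * q ^ n.choose 2 * qShifted x' q n :=
    fun n h => by simpa [qShifted_zero] using qShifted_reverse hq _ _ n 0 (by simpa using h)
  have hAm : qShifted A q (m + 1) = (1 - A) * qShifted (A * q) q m := qShifted_succ' _ _ _
  have hAm0 : qShifted A q (m + 1) ≠ 0 := qShifted_ne_zero_of_le hA0 (by omega)
  rw [hAm] at hAm0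
  have hA1 := left_ne_zero_of_mul hAm0
  have hAq := right_ne_zero_of_mul hAm0
  have hZfull := hfull (x := Z * q ^ k) (x' := e / q ^ k) m (by
    field_simp; linear_combination hZ)
  have hXm := hfull (x := q ^ m * X) (x' := e * w) m (by linear_combination hX)
  have hXk := hfull (x := q ^ m * X) (x' := e * w * q ^ m / q ^ k) k (by
    field_simp; linear_combination hX)
  have hWm := hfull m hW
  have hHm := hfull m hH
  have hZH : q ^ m * X * W = Z * H := by
    have hH' : H * w ^ 2 * q ^ m = q := by linear_combination hH - H * q ^ m * hA
    apply mul_right_cancel₀ (b := e * w ^ 2 * (q ^ m) ^ 2) (by positivity)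
    linear_combination W * w * q ^ m * hX + q * hW - H * w ^ 2 * q ^ m * hZ - q * hH'
  have hpow : (-(q ^ m * X)) ^ m * (-W) ^ m = (-Z) ^ m * (-H) ^ m := by
    rw [← mul_pow, ← mul_pow]; congr 1; linear_combination hZH
  have hH0 : (-H) ^ m ≠ 0 := by
    refine pow_ne_zero _ (neg_ne_zero.2 ?_)
    rintro rfl; simp at hH; exact hq hH.symm
  have hpre : qShifted (q ^ m * X) q m * qShifted W q m / qShifted H q m =
      (-Z) ^ m * q ^ m.choose 2 * qShifted (e * w) q m * qShifted w q m /
        qShifted (A * q) q m := by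
    rw [hXm, hWm, hHm]
    rw [div_eq_div_iff (by positivity) hAq]
    linear_combination (q ^ m.choose 2) ^ 2 * qShifted (e * w) q m * qShifted w q m *
      qShifted (A * q) q m * hpow
  rw [hpre, hZfull, ← hV, Finset.mul_sum, Finset.mul_sum, Finset.mul_sum]
  refine Finset.sum_congr rfl fun j hj => ?_
  obtain ⟨r, rfl⟩ := Nat.exists_eq_add_of_le (Finset.mem_range_succ_iff.1 hj)
  rw [show 2 * (j + r) - j = j + r + r by omega, Nat.add_sub_cancel_left]
  have f1 := hfull (x := q ^ (j + r + r) * X) (x' := e * w * q ^ j / q ^ k) k (by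
    field_simp; linear_combination hX)
  have f2 : qShifted (e * w * q ^ j / q ^ k) q k * qShifted (e * w * q ^ j) q r =
      qShifted (e * w * q ^ j / q ^ k) q r * qShifted (e * w * q ^ (j + r) / q ^ k) q k := by
    have := qShifted_mul_comm (e * w * q ^ j / q ^ k) q k r
    rw [div_mul_cancel₀ _ hqk] at this
    rw [this]; congr 2; rw [pow_add]; ring
  have f3 := qShifted_add (e * w) q j r
  have f4 := qShifted_mul_comm C q j k
  have f5 := qShifted_reverse hq y q j r (by linear_combination q * hy)
  have f6 : qShifted A q (j + r + j + 1) =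
      (1 - A) * qShifted (A * q) q (j + r) * qShifted (A * q ^ (j + r + 1)) q j := by
    rw [← hAm, ← qShifted_add]; congr 1; ring
  have hA2 : qShifted (A * q ^ (j + r + 1)) q j ≠ 0 := by
    have : qShifted A q (j + r + j + 1) ≠ 0 := qShifted_ne_zero_of_le hA0 (by omega)
    rw [f6] at this
    exact right_ne_zero_of_mul this
  rw [f3] at hD
  have hDj := left_ne_zero_of_mul hD
  have hDr := right_ne_zero_of_mul hD
  rw [show e / q ^ k * w * q ^ j = e * w * q ^ j / q ^ k by ring, f6, f1, f3, hXk]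
  have e1 : (-(Z * q ^ k)) ^ (j + r) = (-Z) ^ (j + r) * ((q ^ k) ^ j * (q ^ r) ^ k) := by
    rw [neg_mul_eq_neg_mul, mul_pow, pow_add (q ^ k), ← pow_mul, ← pow_mul, ← pow_mul,
      mul_comm r k]
  have e2 : (-(q ^ (j + r + r) * X)) ^ k = (-(q ^ (j + r) * X)) ^ k * (q ^ r) ^ k := by
    rw [← mul_pow]; congr 1; ring
  have e3 : (e * q ^ (j + r)) ^ j * (-y) ^ j = (-1) ^ j * e ^ j := by
    rw [← mul_pow, ← mul_pow]; congr 1; linear_combination -e * hy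
  have hPr := hP r
  have hPj := hP j
  have f5' : qShifted y q j =
      (-y) ^ j * q ^ j.choose 2 * qShifted q q (j + r) / qShifted q q r := by
    rw [← f5]; field_simp
  have f2' : qShifted (e * w * q ^ j / q ^ k) q k = qShifted (e * w * q ^ j / q ^ k) q r *
      qShifted (e * w * q ^ (j + r) / q ^ k) q k / qShifted (e * w * q ^ j) q r := by
    rw [← f2]; field_simp
  rw [e1, e2, f5', f2', div_pow]
  generalize (-(q ^ (j + r) * X)) ^ k = g1 at *
  generalize (-Z) ^ (j + r) = g2 at *
  generalize qShifted (e * w * q ^ j / q ^ k) q r = g3 at *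
  generalize qShifted (e * w * q ^ (j + r) / q ^ k) q k = g4 at *
  generalize qShifted (e * w * q ^ j) q r = g5 at *
  generalize qShifted (A * q ^ (j + r + 1)) q j = g6 at *
  generalize qShifted (C * q ^ j) q k = g7 at *
  generalize qShifted (C * q ^ k) q j = g8 at *
  generalize (e * q ^ (j + r)) ^ j = g9 at *
  have hqkj : (q ^ k) ^ j ≠ 0 := pow_ne_zero _ hqk
  generalize (q ^ k) ^ j = g10 at *
  generalize qShifted (e * w) q j = g11 at *
  generalize qShifted (A * q) q (j + r) = g12 at *
  field_simp
  linear_combination -(g1 * g2 * g3 * g4 * qShifted q q (j + r) * (1 - A * q ^ (2 * j)) *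
    qShifted A q j * qShifted w q (j + r)) *
      ((-1) ^ j * e ^ j * f4 + qShifted C q j * g7 * e3)

/-! ### Removing the parameter `l` -/

theorem qShifted_two_mul (q : ℂ) (n : ℕ) :
    qShifted q q (2 * n) = qShifted q (q ^ 2) n * qShifted (q ^ 2) (q ^ 2) n := by
  induction n with
  | zero => simp [qShifted_zero]
  | succ n ih =>
    rw [show 2 * (n + 1) = 2 * n + 1 + 1 by ring]
    simp only [qShifted_succ, ih]
    ring

/-- Andrews' `q`-Watson summation as a terminating `₄φ₃`; `v` stands for `q ^ (-n)`. -/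
theorem watson_series {q : ℂ} (hq : q ≠ 0) (hroot : ∀ k : ℕ, 0 < k → q ^ k ≠ 1)
    {v x y σ : ℂ} (n : ℕ) (hv : v * q ^ n = 1) (hσ : σ ^ 2 = q * x * y)
    (hσ0 : qShifted (σ ^ 2) (q ^ 2) n ≠ 0) :
    ∑ r ∈ Finset.range (n + 1),
      qShifted v q r * qShifted (-v) q r * qShifted x q r * qShifted y q r /
        (qShifted q q r * qShifted (v ^ 2) q r * qShifted σ q r * qShifted (-σ) q r) * q ^ r =
    qShifted (q * x) (q ^ 2) n * qShifted (q * y) (q ^ 2) n /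
      (qShifted q (q ^ 2) n * qShifted (σ ^ 2) (q ^ 2) n) := by
  have hroot2 : ∀ k : ℕ, 0 < k → (q ^ 2) ^ k ≠ 1 := fun k hk => by
    rw [← pow_mul]; exact hroot _ (by omega)
  have hP := qShifted_self_ne_zero hroot
  have hP2 := qShifted_self_ne_zero hroot2
  have hv0 : v ≠ 0 := left_ne_zero_of_mul (hv.trans_ne one_ne_zero)
  rw [← watson hroot x y n, Finset.sum_div]
  refine Finset.sum_congr rfl fun r hr => ?_
  obtain ⟨t, rfl⟩ := Nat.exists_eq_add_of_le (Finset.mem_range_succ_iff.1 hr)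
  rw [Nat.add_sub_cancel_left, show 2 * (r + t) - r = r + 2 * t by omega]
  have hv2 : v ^ 2 * q ^ (r + (r + 2 * t)) = 1 := by
    rw [show r + (r + 2 * t) = (r + t) * 2 by ring, pow_mul, ← mul_pow, hv, one_pow]
  have h1 := qShifted_reverse (pow_ne_zero 2 hq) (v ^ 2) (q ^ 2) r t (by
    linear_combination q ^ 2 * hv2)
  have h2 := qShifted_reverse hq (v ^ 2) q r (r + 2 * t) (by linear_combination q * hv2)
  rw [show r + (r + 2 * t) = 2 * (r + t) by ring, qShifted_two_mul] at h2
  have h1' : qShifted (v ^ 2) (q ^ 2) r = (-v ^ 2) ^ r * (q ^ 2) ^ r.choose 2 *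
      qShifted (q ^ 2) (q ^ 2) (r + t) / qShifted (q ^ 2) (q ^ 2) t := by
    rw [← h1]; have := hP2 t; field_simp
  have h2' : qShifted (v ^ 2) q r = (-v ^ 2) ^ r * q ^ r.choose 2 *
      (qShifted q (q ^ 2) (r + t) * qShifted (q ^ 2) (q ^ 2) (r + t)) /
        qShifted q q (r + 2 * t) := by
    rw [← h2]; have := hP (r + 2 * t); field_simp
  rw [qShifted_add (σ ^ 2)] at hσ0 ⊢
  rw [show σ ^ 2 * (q ^ 2) ^ r = x * y * q ^ (2 * r + 1) by rw [hσ]; ring] at hσ0 ⊢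
  have := right_ne_zero_of_mul hσ0
  rw [mul_assoc _ (qShifted σ q r), qShifted_mul_neg, qShifted_mul_neg, h1', h2', ← pow_mul,
    mul_comm 2, pow_mul, pow_choose_two_succ]
  have := hP2 (r + t)
  have : (-v ^ 2) ^ r ≠ 0 := pow_ne_zero _ (neg_ne_zero.2 (pow_ne_zero _ hv0))
  generalize qShifted (x * y * q ^ (2 * r + 1)) (q ^ 2) t = g at *
  generalize qShifted (σ ^ 2) (q ^ 2) r = g' at *
  generalize (-v ^ 2) ^ r = g'' at *
  field_simp

theorem sum_range_drop (f : ℕ → ℂ) (i n : ℕ) (h : ∀ k < i, f k = 0) :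
    ∑ k ∈ Finset.range (i + n + 1), f k = ∑ r ∈ Finset.range (n + 1), f (i + r) := by
  rw [add_assoc, Finset.sum_range_add, Finset.sum_eq_zero, zero_add]
  exact fun k hk => h k (Finset.mem_range.1 hk)

/-- Expansion of the factor of a terminating series that depends on `l` in terms of the case
`l = 0` with shifted parameters; `w`, `w * q ^ l`, `w * q ^ n`, `κ` stand for `q ^ (-l - n)`,
`q ^ (-n)`, `q ^ (-l)`, `q ^ (-k)`. The factor `(κ)_i / ((-κ) ^ i q ^ (i.choose 2))` equals
`(q)_k / (q)_(k - i)` for `i ≤ k`, and unlike the latter it vanishes for `k < i`. It is the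
summation `wellPoised` with base parameter `w ^ 2 / q`. -/
theorem expand_degree {q : ℂ} (hq : q ≠ 0) (hroot : ∀ k : ℕ, 0 < k → q ^ k ≠ 1)
    {w κ : ℂ} (l n k : ℕ) (hw : w * q ^ (l + n) = 1) (hκ : κ * q ^ k = 1) (hk : k ≤ l + n) :
    qShifted (w * q ^ l) q k / qShifted (w ^ 2 * q ^ l) q k =
      ∑ i ∈ Finset.range (l + 1),
        (-1) ^ i * q ^ i.choose 2 * (w * q ^ l) ^ i * qShifted (w * q ^ n) q i /
          (qShifted q q i * qShifted (w ^ 2 * q ^ l) q i * qShifted (w ^ 2 / q * q ^ i) q i) *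
          ((-κ) ^ i * q ^ i.choose 2)⁻¹ * qShifted κ q i *
          (qShifted w q k / qShifted (w ^ 2 * q ^ (2 * i)) q (k - i)) := by
  have hP := qShifted_self_ne_zero hroot
  have hκ0 : κ ≠ 0 := left_ne_zero_of_mul (hκ.trans_ne one_ne_zero)
  have hw2 : w ^ 2 * q ^ (2 * (l + n)) = 1 := by
    rw [mul_comm 2, pow_mul, ← mul_pow, hw, one_pow]
  set B := w ^ 2 / q with hB
  have hBq : B * q = w ^ 2 := by rw [hB]; field_simp
  have hB0 : ∀ t ≤ 2 * (l + n) + 1, qShifted B q t ≠ 0 := fun t ht =>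
    qShifted_ne_zero fun i hi h => by
      obtain ⟨d, hd⟩ := Nat.exists_eq_add_of_lt (show i < 2 * (l + n) + 1 by omega)
      refine hroot (d + 1) d.succ_pos ?_
      have : B * q ^ (2 * (l + n) + 1) = 1 := by rw [← hw2, ← hBq]; ring
      rw [hd, show i + d + 1 = i + (d + 1) by ring, pow_add, ← mul_assoc, h, one_mul] at this
      exact this
  have hW : qShifted w q l ≠ 0 := qShifted_ne_zero fun i hi h => by
    obtain ⟨d, hd⟩ := Nat.exists_eq_add_of_lt (show i < l + n by omega)
    refine hroot (d + 1) d.succ_pos ?_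
    rw [hd, show i + d + 1 = i + (d + 1) by ring, pow_add, ← mul_assoc, h, one_mul] at hw
    exact hw
  have hV := wellPoised hq hroot B w κ (w * q ^ k) hBq (by linear_combination w * hκ) l
    (hB0 _ (by omega))
  have h1 : qShifted (w * q ^ l) q k =
      qShifted w q k * qShifted (w * q ^ k) q l / qShifted w q l := by
    rw [← qShifted_mul_comm]; field_simp
  rw [h1, ← hV, Finset.mul_sum, Finset.sum_div, Finset.sum_div]
  refine Finset.sum_congr rfl fun i hi => ?_
  rcases lt_or_ge k i with hki | hik
  · rw [qShifted_eq_zero hκ hki]; simp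
  obtain ⟨r, rfl⟩ := Nat.exists_eq_add_of_le hik
  obtain ⟨s, rfl⟩ := Nat.exists_eq_add_of_le (Finset.mem_range_succ_iff.1 hi)
  rw [Nat.add_sub_cancel_left, Nat.add_sub_cancel_left]
  have f1 := qShifted_reverse hq (w * q ^ n) q i s (by
    rw [pow_add _ _ n] at hw; linear_combination q * hw)
  have f3 : qShifted B q (i + s + i + 1) =
      qShifted B q (i + s + 1) * qShifted (w ^ 2 * q ^ (i + s)) q i := by
    rw [show i + s + i + 1 = i + s + 1 + i by ring, qShifted_add, pow_succ' q, ← mul_assoc, hBq]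
  have f4 : qShifted B q (i + r + 1 + i) * qShifted (w ^ 2 * q ^ (i + r) * q ^ i) q s =
      qShifted B q (i + s + 1) * qShifted (w ^ 2 * q ^ (i + s)) q (i + r) := by
    have e1 := qShifted_add B q (i + r + 1 + i) s
    have e2 := qShifted_add B q (i + s + 1) (i + r)
    rw [show B * q ^ (i + r + 1 + i) = w ^ 2 * q ^ (i + r) * q ^ i by rw [← hBq]; ring] at e1
    rw [show B * q ^ (i + s + 1) = w ^ 2 * q ^ (i + s) by rw [← hBq]; ring] at e2
    rw [← e1, ← e2]; congr 1; ring
  have f5 : qShifted B q (i + r + 1 + i) = qShifted B q i * qShifted (B * q ^ i) q i *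
      (1 - B * q ^ (2 * i)) * qShifted (w ^ 2 * q ^ (2 * i)) q r := by
    rw [show i + r + 1 + i = i + i + 1 + r by ring, qShifted_add, qShifted_succ, qShifted_add,
      ← two_mul, pow_succ' q (2 * i), ← mul_assoc B q, hBq]
  have n3 := hB0 (i + s + i + 1) (by omega)
  have n5 := hB0 (i + r + 1 + i) (by omega)
  have n4 : qShifted B q (i + s + 1 + (i + r)) ≠ 0 := hB0 _ (by omega)
  rw [qShifted_add, show B * q ^ (i + s + 1) = w ^ 2 * q ^ (i + s) by rw [← hBq]; ring] at n4
  rw [f3] at n3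
  have m1 := right_ne_zero_of_mul n4
  have m2 := right_ne_zero_of_mul n3
  have m3 := left_ne_zero_of_mul n3
  rw [f5] at n5 f4
  have m4 := right_ne_zero_of_mul n5
  have n6 := left_ne_zero_of_mul n5
  have m6 := right_ne_zero_of_mul (left_ne_zero_of_mul n6)
  have hPs := hP s
  have hPi := hP i
  have hPl := hP (i + s)
  have f1' : qShifted (w * q ^ n) q i = (-(w * q ^ n)) ^ i * q ^ i.choose 2 *
      qShifted q q (i + s) / qShifted q q s := by rw [← f1]; field_simp
  have hpow : (w * q ^ (i + s)) ^ i * (-(w * q ^ n)) ^ i = (w * q ^ (i + r)) ^ i * (-κ) ^ i := by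
    rw [← mul_pow, ← mul_pow]; congr 1
    rw [pow_add _ _ n] at hw
    linear_combination w * hκ - w * hw
  have hκi : (-κ) ^ i ≠ 0 := pow_ne_zero _ (neg_ne_zero.2 hκ0)
  rw [f3, f1', show w * q ^ (i + r) * w * q ^ i = w ^ 2 * q ^ (i + r) * q ^ i by ring]
  generalize (-(w * q ^ n)) ^ i = g1 at *
  generalize (w * q ^ (i + s)) ^ i = g2 at *
  generalize (w * q ^ (i + r)) ^ i = g3 at *
  generalize qShifted (w ^ 2 * q ^ (i + r) * q ^ i) q s = g4 at *
  generalize qShifted (w ^ 2 * q ^ (i + s)) q (i + r) = g5 at *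
  generalize qShifted (w ^ 2 * q ^ (i + s)) q i = g6 at *
  generalize qShifted (w ^ 2 * q ^ (2 * i)) q r = g7 at *
  generalize qShifted (B * q ^ i) q i = g8 at *
  generalize (-κ) ^ i = g9 at *
  generalize 1 - B * q ^ (2 * i) = g10 at *
  clear hV hB0 hBq hB
  field_simp
  linear_combination qShifted w q (i + r) * qShifted κ q i *
    (g3 * g9 * f4 - qShifted B q (i + s + 1) * g5 * hpow)

/-- The terminating series with `l` as a parameter, as a sum over `i ≤ l` of series that
`watson_series` evaluates; `w` stands for `q ^ (-l - n)`. -/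
theorem sum_eq_sum_watson {q : ℂ} (hq : q ≠ 0) (hroot : ∀ k : ℕ, 0 < k → q ^ k ≠ 1)
    {w x y σ : ℂ} (l n : ℕ) (hw : w * q ^ (l + n) = 1) (hσ : σ ^ 2 = q * x * y)
    (hσ0 : qShifted (σ ^ 2) (q ^ 2) (l + n) ≠ 0) :
    ∑ k ∈ Finset.range (n + 1),
      qShifted (w * q ^ l) q k * qShifted (-w) q k * qShifted x q k * qShifted y q k /
        (qShifted q q k * qShifted (w ^ 2 * q ^ l) q k * qShifted σ q k * qShifted (-σ) q k) *
          q ^ k =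
    ∑ i ∈ Finset.range (l + 1),
      (-1) ^ i * q ^ (i + 1).choose 2 * (w * q ^ l) ^ i *
        (qShifted (w * q ^ n) q i * qShifted w q i * qShifted (-w) q i * qShifted x q i *
            qShifted y q i /
          (qShifted q q i * qShifted σ q i * qShifted (-σ) q i * qShifted (w ^ 2 * q ^ l) q i *
            qShifted (w ^ 2 / q * q ^ i) q i)) *
        (qShifted (q * (x * q ^ i)) (q ^ 2) (l + n - i) *
            qShifted (q * (y * q ^ i)) (q ^ 2) (l + n - i) /
          (qShifted q (q ^ 2) (l + n - i) *
            qShifted ((σ * q ^ i) ^ 2) (q ^ 2) (l + n - i))) := by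
  have hP := qShifted_self_ne_zero hroot
  have hq0 : ∀ i, q ^ i ≠ 0 := fun i => pow_ne_zero _ hq
  -- The summand vanishes for `n < k`, so the summation may be extended to `k ≤ l + n`.
  have hext : ∑ k ∈ Finset.range (n + 1),
      qShifted (w * q ^ l) q k * qShifted (-w) q k * qShifted x q k * qShifted y q k /
        (qShifted q q k * qShifted (w ^ 2 * q ^ l) q k * qShifted σ q k * qShifted (-σ) q k) *
          q ^ k = ∑ k ∈ Finset.range (l + n + 1),
      qShifted (w * q ^ l) q k * qShifted (-w) q k * qShifted x q k * qShifted y q k /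
        (qShifted q q k * qShifted (w ^ 2 * q ^ l) q k * qShifted σ q k * qShifted (-σ) q k) *
          q ^ k := by
    refine Finset.sum_subset (Finset.range_subset_range.2 (by omega)) fun k _ hk => ?_
    rw [qShifted_eq_zero (x := w * q ^ l) (k := n) (by rw [← hw]; ring)
      (by simpa using hk)]
    simp
  have hterm : ∀ k ∈ Finset.range (l + n + 1),
      qShifted (w * q ^ l) q k * qShifted (-w) q k * qShifted x q k * qShifted y q k /
        (qShifted q q k * qShifted (w ^ 2 * q ^ l) q k * qShifted σ q k * qShifted (-σ) q k) *
          q ^ k =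
      ∑ i ∈ Finset.range (l + 1),
        (-1) ^ i * q ^ i.choose 2 * (w * q ^ l) ^ i * qShifted (w * q ^ n) q i /
          (qShifted q q i * qShifted (w ^ 2 * q ^ l) q i * qShifted (w ^ 2 / q * q ^ i) q i) *
          ((-(q ^ k)⁻¹) ^ i * q ^ i.choose 2)⁻¹ * qShifted (q ^ k)⁻¹ q i *
          (qShifted w q k / qShifted (w ^ 2 * q ^ (2 * i)) q (k - i)) *
          (qShifted (-w) q k * qShifted x q k * qShifted y q k /
            (qShifted q q k * (qShifted σ q k * qShifted (-σ) q k)) * q ^ k) := fun k hk => by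
    rw [← Finset.sum_mul, ← expand_degree hq hroot l n k hw (inv_mul_cancel₀ (hq0 k))
      (Finset.mem_range_succ_iff.1 hk)]
    simp only [div_eq_mul_inv, mul_inv]
    ring
  rw [hext, Finset.sum_congr rfl hterm, Finset.sum_comm]
  refine Finset.sum_congr rfl fun i hi => ?_
  obtain ⟨s, rfl⟩ := Nat.exists_eq_add_of_le (Finset.mem_range_succ_iff.1 hi)
  rw [show i + s + n = i + (s + n) by ring] at *
  rw [sum_range_drop _ _ _ fun k hk => by
    rw [qShifted_eq_zero (inv_mul_cancel₀ (hq0 k)) hk]; simp, Nat.add_sub_cancel_left]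
  rw [← watson_series hq hroot (v := w * q ^ i) (x := x * q ^ i) (y := y * q ^ i)
    (σ := σ * q ^ i) (s + n) (by rw [← hw]; ring) (by rw [mul_pow, hσ]; ring) (by
      rw [qShifted_add] at hσ0
      convert right_ne_zero_of_mul hσ0 using 2; ring), Finset.mul_sum]
  refine Finset.sum_congr rfl fun r hr => ?_
  rw [Nat.add_sub_cancel_left]
  have f := qShifted_reverse hq (q ^ (i + r))⁻¹ q i r (by have := hq0 (i + r); field_simp)
  have hPr := hP r
  have hPk := hP (i + r)
  have hg : (-(q ^ (i + r))⁻¹) ^ i * q ^ i.choose 2 ≠ 0 :=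
    mul_ne_zero (pow_ne_zero _ (neg_ne_zero.2 (inv_ne_zero (hq0 _)))) (hq0 _)
  have f' : ((-(q ^ (i + r))⁻¹) ^ i * q ^ i.choose 2)⁻¹ * qShifted (q ^ (i + r))⁻¹ q i =
      qShifted q q (i + r) / qShifted q q r := by
    rw [eq_div_iff hPr, mul_assoc, f, ← mul_assoc, inv_mul_cancel₀ hg, one_mul]
  rw [mul_assoc _ (_⁻¹), f', pow_choose_two_succ,
    show (w * q ^ i) ^ 2 = w ^ 2 * q ^ (2 * i) by ring]
  have cancel : ∀ a b c d e f : ℂ, a * (qShifted q q (i + r) / b) * c *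
      (d / (qShifted q q (i + r) * e) * f) = a / b * c * (d / e * f) := fun a b c d e f => by
    field_simp
  rw [cancel]
  simp only [qShifted_add _ q i r, pow_add, ← neg_mul]
  simp only [div_eq_mul_inv, mul_inv]
  ring

/-! ### The double sum -/

/-- The reversed series as a double sum: the parameter `m` is removed by `expand_shifted`, and the
parameter `l` by `sum_eq_sum_watson`; `w` and `t` stand for `q ^ (-l - n)` and `q ^ (-m)`. -/
theorem sum_eq_double_sum {q : ℂ} (hq : q ≠ 0) (hroot : ∀ k : ℕ, 0 < k → q ^ k ≠ 1)
    {A ω C e X Z W H t w : ℂ} (l n m : ℕ) (hA : A * q = ω ^ 2) (hC : C * e = ω)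
    (hZ : Z * e * q ^ m = q) (hX : X * (e * ω) * q ^ (2 * m) = q) (hW : W * ω * q ^ m = q)
    (hH : H * (A * q) * q ^ m = q) (ht : t * q ^ m = 1) (hw : w * q ^ (l + n) = 1)
    (hA0 : qShifted A q (2 * m + 1) ≠ 0) (hD : qShifted (e * ω) q m ≠ 0)
    (hZm : qShifted Z q m ≠ 0) (hZ2 : qShifted ((q ^ m * Z) ^ 2) (q ^ 2) (l + n) ≠ 0) :
    ∑ k ∈ Finset.range (n + 1),
      qShifted (w * q ^ l) q k * qShifted C q k * qShifted (-w) q k * qShifted (q ^ m * X) q k /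
        (qShifted q q k * qShifted (w ^ 2 * q ^ l) q k * qShifted Z q k *
          qShifted (-(q ^ m * Z)) q k) * q ^ k =
    qShifted (q ^ m * X) q m * qShifted W q m / (qShifted H q m * qShifted Z q m) *
      ∑ i ∈ Finset.range (l + 1), ∑ j ∈ Finset.range (m + 1),
        (e * q ^ m) ^ j * ((1 - A * q ^ (2 * j)) / (1 - A)) *
          (qShifted t q j * qShifted C q j * qShifted A q j /
            (qShifted q q j * qShifted (e * ω) q j * qShifted (A * q ^ (m + 1)) q j)) *
          ((-1) ^ i * q ^ (i + 1).choose 2 * (w * q ^ l) ^ i *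
            (qShifted (w * q ^ n) q i * qShifted w q i * qShifted (-w) q i *
                qShifted (q ^ (2 * m - j) * X) q i * qShifted (C * q ^ j) q i /
              (qShifted q q i * qShifted (q ^ m * Z) q i * qShifted (-(q ^ m * Z)) q i *
                qShifted (w ^ 2 * q ^ l) q i * qShifted (w ^ 2 / q * q ^ i) q i)) *
            (qShifted (q * (q ^ (2 * m - j) * X * q ^ i)) (q ^ 2) (l + n - i) *
                qShifted (q * (C * q ^ j * q ^ i)) (q ^ 2) (l + n - i) /
              (qShifted q (q ^ 2) (l + n - i) *
                qShifted ((q ^ m * Z * q ^ i) ^ 2) (q ^ 2) (l + n - i)))) := by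
  have he0 : e ≠ 0 := by rintro rfl; simp at hX; exact hq hX.symm
  have hσ : ∀ j ≤ m, (q ^ m * Z) ^ 2 = q * (q ^ (2 * m - j) * X) * (C * q ^ j) := fun j hj => by
    rw [show q * (q ^ (2 * m - j) * X) * (C * q ^ j) = q * (q ^ (2 * m - j + j) * X) * C by
      rw [pow_add]; ring, Nat.sub_add_cancel (by omega)]
    apply mul_right_cancel₀ (b := e ^ 2) (pow_ne_zero 2 he0)
    linear_combination (q ^ m * Z * e + q) * hZ - q * hX - q * q ^ (2 * m) * X * e * hC
  have hσn : ∀ k ≤ n, qShifted (q ^ m * Z) q k * qShifted (-(q ^ m * Z)) q k ≠ 0 := fun k hk => by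
    rw [qShifted_mul_neg]; exact qShifted_ne_zero_of_le hZ2 (by omega)
  have hterm : ∀ k ∈ Finset.range (n + 1),
      qShifted (w * q ^ l) q k * qShifted C q k * qShifted (-w) q k * qShifted (q ^ m * X) q k /
        (qShifted q q k * qShifted (w ^ 2 * q ^ l) q k * qShifted Z q k *
          qShifted (-(q ^ m * Z)) q k) * q ^ k =
      ∑ j ∈ Finset.range (m + 1),
        qShifted (q ^ m * X) q m * qShifted W q m / (qShifted H q m * qShifted Z q m) *
        ((e * q ^ m) ^ j * ((1 - A * q ^ (2 * j)) / (1 - A)) *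
          (qShifted t q j * qShifted C q j * qShifted A q j /
            (qShifted q q j * qShifted (e * ω) q j * qShifted (A * q ^ (m + 1)) q j))) *
        (qShifted (w * q ^ l) q k * qShifted (-w) q k * qShifted (q ^ (2 * m - j) * X) q k *
            qShifted (C * q ^ j) q k /
          (qShifted q q k * qShifted (w ^ 2 * q ^ l) q k * qShifted (q ^ m * Z) q k *
            qShifted (-(q ^ m * Z)) q k) * q ^ k) := fun k hk => by
    have hk' := Finset.mem_range_succ_iff.1 hk
    have hE := expand_shifted hq hroot m k hA hC hZ hX hW hH ht hA0 hD
    have hs := hσn k hk'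
    have hs1 := left_ne_zero_of_mul hs
    have hcomm := qShifted_mul_comm Z q k m
    rw [mul_comm Z (q ^ m)] at hcomm
    have hne : qShifted Z q k * qShifted (Z * q ^ k) q m ≠ 0 := by
      rw [hcomm]; exact mul_ne_zero hZm hs1
    have hZkm := right_ne_zero_of_mul hne
    have hkey : qShifted C q k * qShifted (q ^ m * X) q k / qShifted Z q k =
        qShifted C q k * qShifted (q ^ m * X) q k * qShifted (Z * q ^ k) q m /
          (qShifted Z q m * qShifted (q ^ m * Z) q k) := by
      rw [← hcomm]; field_simp
    rw [hE, Finset.mul_sum, Finset.sum_div] at hkey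
    calc _ = qShifted C q k * qShifted (q ^ m * X) q k / qShifted Z q k *
          (qShifted (w * q ^ l) q k * qShifted (-w) q k / (qShifted q q k *
            qShifted (w ^ 2 * q ^ l) q k * qShifted (-(q ^ m * Z)) q k) * q ^ k) := by
          simp only [div_eq_mul_inv, mul_inv]; ring
      _ = _ := by
          rw [hkey, Finset.sum_mul]
          refine Finset.sum_congr rfl fun j _ => ?_
          simp only [div_eq_mul_inv, mul_inv]; ring
  rw [Finset.sum_congr rfl hterm, Finset.sum_comm, Finset.mul_sum]
  simp only [Finset.mul_sum]
  rw [Finset.sum_comm (s := Finset.range (l + 1))]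
  refine Finset.sum_congr rfl fun j hj => ?_
  rw [← Finset.mul_sum, sum_eq_sum_watson hq hroot l n hw
    (hσ j (Finset.mem_range_succ_iff.1 hj)) hZ2, Finset.mul_sum]
  exact Finset.sum_congr rfl fun i _ => by rw [mul_assoc]

theorem theorem11 (n l m : ℕ) (q a c p α γ : ℂ)
    (hp : p ^ 2 = q) (hα : α ^ 2 = a) (hγ : γ ^ 2 = c)
    (hq : q ≠ 0) (ha : a ≠ 0) (hc : c ≠ 0)
    (hroot : ∀ k : ℕ, 0 < k → q ^ k ≠ 1)
    (h1 : qShifted (q ^ (1 + l + m) * a) q n ≠ 0)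
    (h2 : qShifted (q * c) q n ≠ 0)
    (h3 : qShifted (q ^ m * a * c) q m ≠ 0)
    (h4 : qShifted (q ^ (-n : ℤ) * (p * α / γ)) q m ≠ 0)
    (h5 : 1 - q ^ (2 * m) * a * c ≠ 0)
    (h6 : qShifted (q ^ (1 - 2 * m + n : ℤ) / a) q m ≠ 0)
    (h7 : qShifted (q ^ (1 - m : ℤ) / (a * c)) q m ≠ 0)
    (h8 : qShifted (q ^ (1 + 2 * m - 2 * n : ℤ) * a / c) (q ^ 2) (l + n) ≠ 0) :
    Summable (qHypTerm q q
      [q ^ (-n : ℤ), q ^ (1 + l + n), p * α * γ, -(q ^ m * (p * α * γ))]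
      [-q, q ^ (1 + l + m) * a, q * c]) ∧
    qHyp q q
      [q ^ (-n : ℤ), q ^ (1 + l + n), p * α * γ, -(q ^ m * (p * α * γ))]
      [-q, q ^ (1 + l + m) * a, q * c] =
    qFrac q
      [q ^ (-n : ℤ) * (p * α / γ), -(q ^ (m - n : ℤ) * (p * α / γ)), q ^ (1 + l + n)]
      [q ^ (1 + l + m) * a, q ^ (-n : ℤ) / c, -q] n *
    qFrac q
      [q ^ (m - n : ℤ) * a, p * α * γ]
      [q ^ m * a * c, q ^ (-n : ℤ) * (p * α / γ)] m *
    ∑ i ∈ Finset.range (l + 1), ∑ j ∈ Finset.range (m + 1),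
      (-1) ^ i *
      (p ^ ((2 * n + 5) * j) * q ^ (-(n * i) + (Nat.choose (i + 1) 2) : ℤ)) *
      (γ / α) ^ j *
      ((1 - q ^ (2 * m - 2 * j : ℤ) * a * c) / (1 - q ^ (2 * m) * a * c)) *
      qFrac q
        [q ^ (-l : ℤ), q ^ (-l - n : ℤ), -q ^ (-l - n : ℤ),
          q ^ (2 * m - n - j : ℤ) * a, q ^ (j - n : ℤ) / c]
        [q, q ^ (m - n : ℤ) * (p * α / γ), -(q ^ (m - n : ℤ) * (p * α / γ)),
          q ^ (-l - 2 * n : ℤ), q ^ (i - 2 * l - 2 * n - 1 : ℤ)] i *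
      qFrac q
        [q ^ (-m : ℤ), q ^ (-n : ℤ) / c, q ^ (-2 * m : ℤ) / (a * c)]
        [q, q ^ (1 - 2 * m + n : ℤ) / a, q ^ (1 - m : ℤ) / (a * c)] j *
      qFrac (q ^ 2)
        [q ^ (1 + 2 * m - n + i - j : ℤ) * a, q ^ (1 - n + i + j : ℤ) / c]
        [q, q ^ (1 + 2 * m - 2 * n + 2 * i : ℤ) * a / c] (l + n - i) := by
  have hq0 : ∀ i : ℕ, q ^ i ≠ 0 := fun i => pow_ne_zero _ hq
  have hp0 : p ≠ 0 := by rintro rfl; exact hq (by rw [← hp]; ring)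
  have hα0 : α ≠ 0 := by rintro rfl; exact ha (by rw [← hα]; ring)
  have hγ0 : γ ≠ 0 := by rintro rfl; exact hc (by rw [← hγ]; ring)
  -- `y = q ^ (-n)`, `w = q ^ (-l - n)`, `t = q ^ (-m)`, and the square root `s` of `q * a / c`.
  obtain ⟨y, hy⟩ : ∃ y : ℂ, y * q ^ n = 1 := ⟨_, inv_mul_cancel₀ (hq0 n)⟩
  obtain ⟨w, hw⟩ : ∃ w : ℂ, w * q ^ (l + n) = 1 := ⟨_, inv_mul_cancel₀ (hq0 _)⟩
  obtain ⟨t, ht⟩ : ∃ t : ℂ, t * q ^ m = 1 := ⟨_, inv_mul_cancel₀ (hq0 m)⟩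
  have hy0 : y ≠ 0 := left_ne_zero_of_mul (hy.trans_ne one_ne_zero)
  have ht0 : t ≠ 0 := left_ne_zero_of_mul (ht.trans_ne one_ne_zero)
  have hyn : (q ^ n)⁻¹ = y := (eq_inv_of_mul_eq_one_left hy).symm
  have htm : (q ^ m)⁻¹ = t := (eq_inv_of_mul_eq_one_left ht).symm
  have hwy : w * q ^ l = y := by
    apply mul_right_cancel₀ (hq0 n); rw [hy, ← hw]; ring
  have hwl : (q ^ l)⁻¹ = w * q ^ n := by
    rw [inv_eq_iff_eq_inv, eq_comm]; refine inv_eq_of_mul_eq_one_left ?_; rw [← hw]; ring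
  have z1 : q ^ (-n : ℤ) = y := by rw [zpow_neg, zpow_natCast, hyn]
  have z2 : q ^ (m - n : ℤ) = q ^ m * y := by
    rw [zpow_sub₀ hq, zpow_natCast, zpow_natCast, div_eq_mul_inv, hyn]
  have z3 : q ^ (-l : ℤ) = w * q ^ n := by rw [zpow_neg, zpow_natCast, hwl]
  have z4 : q ^ (-l - n : ℤ) = w := by
    rw [zpow_sub₀ hq, z3, zpow_natCast, mul_div_cancel_right₀ _ (hq0 n)]
  have z5 : q ^ (-l - 2 * n : ℤ) = w ^ 2 * q ^ l := by
    rw [show (-l - 2 * n : ℤ) = (-l - n) + -n by ring, zpow_add₀ hq, z4, z1, ← hwy]; ring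
  have z6 : ∀ i : ℕ, q ^ (i - 2 * l - 2 * n - 1 : ℤ) = w ^ 2 / q * q ^ i := fun i => by
    rw [show (i - 2 * l - 2 * n - 1 : ℤ) = (-l - n) + (-l - n) + i - 1 by ring, zpow_sub₀ hq,
      zpow_add₀ hq, zpow_add₀ hq, z4, zpow_natCast, zpow_one]; ring
  have z7 : q ^ (-m : ℤ) = t := by rw [zpow_neg, zpow_natCast, htm]
  have z8 : q ^ (-2 * m : ℤ) = t ^ 2 := by
    rw [show (-2 * m : ℤ) = -m + -m by ring, zpow_add₀ hq, z7]; ring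
  have z9 : q ^ (1 - 2 * m + n : ℤ) = q * t ^ 2 / y := by
    rw [show (1 - 2 * m + n : ℤ) = 1 + -2 * m - -n by ring, zpow_sub₀ hq, zpow_add₀ hq, z8, z1,
      zpow_one]
  have z10 : q ^ (1 - m : ℤ) = q * t := by
    rw [sub_eq_add_neg, zpow_add₀ hq, z7, zpow_one]
  have z11 : q ^ (1 + 2 * m - 2 * n : ℤ) = q * (q ^ m * y) ^ 2 := by
    rw [show (1 + 2 * m - 2 * n : ℤ) = 1 + (m - n) + (m - n) by ring, zpow_add₀ hq, zpow_add₀ hq,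
      z2, zpow_one]; ring
  set s := p * α / γ with hs
  have hs2 : s ^ 2 = q * a / c := by rw [hs, ← hp, ← hα, ← hγ]; ring
  have hs0 : s ≠ 0 := by rw [hs]; positivity
  have hcs : c * s = p * α * γ := by rw [hs, ← hγ]; field_simp
  have hqs : q * a / s = p * α * γ := by
    rw [← hcs, div_eq_iff hs0]; field_simp at hs2; linear_combination -hs2
  have hσ : q ^ (m - n : ℤ) * s = q ^ m * (y * s) := by rw [z2]; ring
  rw [z1] at h4
  have h8' : qShifted ((q ^ m * (y * s)) ^ 2) (q ^ 2) (l + n) ≠ 0 := by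
    convert h8 using 2
    rw [z11, show (q ^ m * (y * s)) ^ 2 = (q ^ m * y) ^ 2 * s ^ 2 by ring, hs2]; ring
  have hσn : qShifted (q ^ m * (y * s)) q n * qShifted (-(q ^ m * (y * s))) q n ≠ 0 := by
    rw [qShifted_mul_neg]; exact qShifted_ne_zero_of_le h8' (by omega)
  -- `(y s)_n (y s q ^ n)_m = (y s)_m (q ^ m y s)_n`, and neither factor on the right vanishes.
  have hZn : qShifted (y * s) q n ≠ 0 := by
    have := qShifted_mul_comm (y * s) q n m
    rw [mul_comm (y * s) (q ^ m)] at this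
    exact left_ne_zero_of_mul (this.trans_ne (mul_ne_zero h4 (left_ne_zero_of_mul hσn)))
  have hw2 : w ^ 2 * q ^ (2 * (l + n)) = 1 := by
    rw [mul_comm 2, pow_mul, ← mul_pow, hw, one_pow]
  have hA'n : qShifted (w ^ 2 * q ^ l) q n ≠ 0 := qShifted_ne_zero fun i hi h => by
    refine hroot (l + 2 * n - i) (by omega) ?_
    rw [← hw2, show 2 * (l + n) = l + i + (l + 2 * n - i) by omega, pow_add, pow_add]
    linear_combination -(q ^ (l + 2 * n - i)) * h
  have hneg : qShifted (-q) q n ≠ 0 := qShifted_ne_zero fun i _ h => by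
    refine hroot (2 * (i + 1)) (by omega) ?_
    linear_combination (q * q ^ i - 1) * (-h)
  have hbcu : q / s * (-(q * t / s)) * (-(q ^ m * a)) = q * c := by
    have : q / s * (-(q * t / s)) * (-(q ^ m * a)) = q ^ 2 * a * (t * q ^ m) / s ^ 2 := by
      field_simp
    rw [this, ht, hs2]; field_simp
  have hcu : -(q * t / s) * (-(q ^ m * a)) = p * α * γ := by
    rw [← hqs]; linear_combination q * a / s * ht
  have hbu : q / s * (-(q ^ m * a)) = -(q ^ m * (p * α * γ)) := by
    rw [← hqs]; ring
  have hEA : -q / q ^ (1 + l + n) = -w := by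
    rw [div_eq_iff (hq0 _)]; linear_combination q * hw
  have hFA : q ^ (1 + l + m) * a / q ^ (1 + l + n) = q ^ m * (y * a) := by
    rw [div_eq_iff (hq0 _)]; linear_combination -(q ^ (1 + l + m) * a) * hy
  have hS := sears_reversed hq hroot (y := y) (A := q ^ (1 + l + n)) (b := q / s)
    (c := -(q * t / s)) (u := -(q ^ m * a)) (E := -q) (F := q ^ (1 + l + m) * a)
    (A' := w ^ 2 * q ^ l) (b' := y * s) (c' := -(q ^ m * (y * s))) (D' := y / c) n hy
    (by ring) (hq0 _) (neg_ne_zero.2 (mul_ne_zero (hq0 _) ha)) (neg_ne_zero.2 hq)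
    (mul_ne_zero (hq0 _) ha) (by linear_combination q * hw2)
    (by field_simp; linear_combination hy)
    (by field_simp; linear_combination q ^ m * t * hy + ht)
    (by rw [hbcu]; field_simp; linear_combination hy) hA'n hZn (right_ne_zero_of_mul hσn)
    (by rw [hbcu]; exact h2) hneg h1
  rw [hbcu, hcu, hbu, hEA, hFA] at hS
  have hAω : t ^ 2 / (a * c) * q = (p * t / (α * γ)) ^ 2 := by
    rw [← hp, ← hα, ← hγ]; field_simp
  have heω : p * γ * t / (α * y) * (p * t / (α * γ)) = q * t ^ 2 / y / a := by
    rw [← hp, ← hα]; field_simp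
  have hH : q ^ m * a * c * (t ^ 2 / (a * c) * q) * q ^ m = q := by
    field_simp; linear_combination (t * q ^ m + 1) * ht
  have hA0 : qShifted (t ^ 2 / (a * c)) q (2 * m + 1) ≠ 0 := by
    rw [show 2 * m + 1 = m + 1 + m by ring, qShifted_add, qShifted_succ']
    have hrev := qShifted_reverse hq _ _ m 0 hH
    rw [qShifted_zero, mul_one, Nat.add_zero] at hrev
    refine mul_ne_zero (mul_ne_zero ?_ (right_ne_zero_of_mul (hrev.symm.trans_ne h3))) ?_
    · intro h
      apply h5
      have h' : t ^ 2 = a * c := by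
        rw [← div_eq_one_iff_eq (mul_ne_zero ha hc)]; exact (sub_eq_zero.1 h).symm
      linear_combination q ^ (2 * m) * h' - (t * q ^ m + 1) * ht
    · convert h7 using 2
      rw [z10]
      field_simp
      linear_combination q * ht
  have hR := sum_eq_double_sum hq hroot (A := t ^ 2 / (a * c)) (ω := p * t / (α * γ))
    (C := y / c) (e := p * γ * t / (α * y)) (X := y * a) (Z := y * s) (W := p * α * γ)
    (H := q ^ m * a * c) (t := t) (w := w) l n m hAω
    (by rw [← hγ]; field_simp)
    (by rw [hs]; field_simp; linear_combination t * q ^ m * hp + q * ht)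
    (by rw [heω]; field_simp; linear_combination (t * q ^ m + 1) * ht)
    (by field_simp; linear_combination t * q ^ m * hp + q * ht)
    hH ht hw hA0 (by rw [heω, ← z9]; exact h6) h4 h8'
  rw [hwy] at hR
  rw [hR] at hS
  have hsum : ∀ k ∉ Finset.range (n + 1), qHypTerm q q
      [q ^ (-n : ℤ), q ^ (1 + l + n), p * α * γ, -(q ^ m * (p * α * γ))]
      [-q, q ^ (1 + l + m) * a, q * c] k = 0 := fun k hk => by
    rw [qHypTerm, qFrac, List.map_cons, List.prod_cons, z1,
      qShifted_eq_zero hy (by simpa using hk)]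
    simp
  refine ⟨summable_of_ne_finset_zero hsum, ?_⟩
  rw [qHyp, tsum_eq_sum hsum]
  simp only [qHypTerm, qFrac, List.map_cons, List.map_nil, List.prod_cons, List.prod_nil, mul_one]
  simp only [hσ, z1, z3, z4, z5, z6, z7, z8, z9, z10]
  rw [z2, mul_assoc (q ^ m) y a, ← heω]
  have hL : ∀ k ∈ Finset.range (n + 1),
      qShifted y q k * (qShifted (q ^ (1 + l + n)) q k *
        (qShifted (p * α * γ) q k * qShifted (-(q ^ m * (p * α * γ))) q k)) /
          (qShifted q q k * (qShifted (-q) q k *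
            (qShifted (q ^ (1 + l + m) * a) q k * qShifted (q * c) q k))) * q ^ k =
      qShifted y q k * qShifted (q ^ (1 + l + n)) q k * qShifted (p * α * γ) q k *
          qShifted (-(q ^ m * (p * α * γ))) q k /
        (qShifted q q k * qShifted (q * c) q k * qShifted (-q) q k *
          qShifted (q ^ (1 + l + m) * a) q k) * q ^ k := fun k _ => by
    simp only [div_eq_mul_inv, mul_inv]; ring
  rw [Finset.sum_congr rfl hL, hS, ← mul_assoc]
  congr 1
  · simp only [div_eq_mul_inv, mul_inv]; ring
  refine Finset.sum_congr rfl fun i hi => Finset.sum_congr rfl fun j hj => ?_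
  obtain ⟨r, rfl⟩ := Nat.exists_eq_add_of_le (Finset.mem_range_succ_iff.1 hj)
  have z12 : q ^ (2 * (j + r : ℕ) - n - j : ℤ) * a = q ^ (2 * (j + r) - j) * (y * a) := by
    rw [show (2 * (j + r : ℕ) - n - j : ℤ) = ((2 * (j + r) - j : ℕ) : ℤ) + -n by
      rw [Nat.cast_sub (by omega)]; push_cast; ring, zpow_add₀ hq, z1, zpow_natCast]; ring
  have z13 : q ^ (j - n : ℤ) / c = y / c * q ^ j := by
    rw [sub_eq_add_neg, zpow_add₀ hq, z1, zpow_natCast]; ring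
  have z14 : q ^ (1 + 2 * (j + r : ℕ) - n + i - j : ℤ) * a =
      q * (q ^ (2 * (j + r) - j) * (y * a) * q ^ i) := by
    rw [← z12, show (1 + 2 * (j + r : ℕ) - n + i - j : ℤ) = 1 + (2 * (j + r : ℕ) - n - j) + i by
      ring, zpow_add₀ hq, zpow_add₀ hq, zpow_one, zpow_natCast]; ring
  have z15 : q ^ (1 - n + i + j : ℤ) / c = q * (y / c * q ^ j * q ^ i) := by
    rw [← z13, show (1 - n + i + j : ℤ) = 1 + (j - n) + i by ring, zpow_add₀ hq, zpow_add₀ hq,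
      zpow_one, zpow_natCast]; ring
  have z16 : q ^ (1 + 2 * (j + r : ℕ) - 2 * n + 2 * i : ℤ) * a / c =
      (q ^ (j + r) * (y * s) * q ^ i) ^ 2 := by
    rw [zpow_add₀ hq, z11, show (2 * i : ℤ) = ((2 * i : ℕ) : ℤ) by push_cast; rfl, zpow_natCast]
    linear_combination -(q ^ (j + r) * y * q ^ i) ^ 2 * hs2
  have z17 : q ^ (-(n * i) + ((i + 1).choose 2 : ℕ) : ℤ) = q ^ (i + 1).choose 2 * y ^ i := by
    rw [zpow_add₀ hq, zpow_natCast, neg_mul_eq_neg_mul, zpow_mul, z1, zpow_natCast]; ring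
  have z18 : q ^ (2 * (j + r : ℕ) - 2 * j : ℤ) = q ^ (2 * r) := by
    rw [← zpow_natCast]; congr 1; push_cast; ring
  have z19 : q * t / (a * c) = t ^ 2 / (a * c) * q ^ (j + r + 1) := by
    rw [pow_succ]; linear_combination -(q * t / (a * c)) * ht
  rw [z12, z13, z14, z15, z16, z17, z18, z19]
  have hcoef : p ^ ((2 * n + 5) * j) * (γ / α) ^ j *
      ((1 - q ^ (2 * r) * a * c) / (1 - q ^ (2 * (j + r)) * a * c)) =
      (p * γ * t / (α * y) * q ^ (j + r)) ^ j *
        ((1 - t ^ 2 / (a * c) * q ^ (2 * j)) / (1 - t ^ 2 / (a * c))) := by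
    have e1 : p ^ ((2 * n + 5) * j) * (γ / α) ^ j =
        (p * γ * t / (α * y) * q ^ (j + r)) ^ j * q ^ (2 * j) := by
      rw [pow_mul p, pow_mul q, ← mul_pow, ← mul_pow]; congr 1
      have e3 : p ^ (2 * n + 5) = p * (q ^ n * q ^ 2) := by rw [← hp]; ring
      rw [e3, mul_div_assoc', div_mul_eq_mul_div, div_mul_eq_mul_div,
        div_eq_div_iff hα0 (mul_ne_zero hα0 hy0)]
      linear_combination p * γ * α * q ^ 2 * (hy - ht)
    have hA1 : 1 - t ^ 2 / (a * c) ≠ 0 := by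
      rw [qShifted_succ'] at hA0
      exact left_ne_zero_of_mul hA0
    have e2 : t ^ 2 / (a * c) * q ^ (2 * (j + r)) * a * c = 1 := by
      field_simp; linear_combination (t * q ^ (j + r) + 1) * ht
    rw [e1, mul_assoc, mul_div_assoc', mul_right_inj' (by positivity), div_eq_div_iff h5 hA1]
    linear_combination (1 - q ^ (2 * j)) * e2
  have rearr : ∀ x P Q G D F₁ F₂ F₃ : ℂ, x * (P * Q) * G * D * F₁ * F₂ * F₃ =
      P * G * D * (x * Q * F₁ * F₂ * F₃) := by intros; ring
  rw [rearr, hcoef]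
  simp only [div_eq_mul_inv, mul_inv]
  ring
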